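/- Let $E$ and $F$ be complex Banach spaces, let $U\subseteq E$ be open, and let $v\colon U\to(0,\infty)$ be continuous. Let $\mathcal H_v^\infty(U,F)$ be the space of all holomorphic maps $f\colon U\to F$ with $\|f\|_v:=\sup_{x\in U}v(x)\|f(x)\|<\infty$, and put $\mathcal H_v^\infty(U)=\mathcal H_v^\infty(U,\mathbb C)$. Let $\mathcal G_v^\infty(U)\subseteq\mathcal H_v^\infty(U)^*$ be the canonical predual of $\mathcal H_v^\infty(U)$, i.e. the norm-closed linear span of the evaluation functionals $\delta_x\colon h\mapsto h(x)$, $x\in U$. For $f\in\mathcal H_v^\infty(U,F)$ let $T_f\colon\mathcal G_v^\infty(U)\to F$ be its linearization, the unique bounded linear operator with $T_f(\delta_x)=f(x)$ for all $x\in U$. A subset $K$ of a complex Banach space $X$ is called a Grothendieck set if $T(K)$ is relatively weakly compact in $c_0$ for every bounded linear operator $T\colon X\to c_0$. A bounded linear operator $T\colon X\to Y$ between complex Banach spaces is called a Grothendieck operator, $T\in\mathcal O(X,Y)$, if it maps the closed unit ball of $X$ to a Grothendieck set in $Y$; $\mathcal O$ carries the operator norm. Let $\mathcal H_{v\mathcal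 O}^\infty(U,F)$ be the set of all $f\in\mathcal H_v^\infty(U,F)$ for which $(vf)(U)=\{v(x)f(x):x\in U\}$ is a Grothendieck set in $F$, with the norm $\|\cdot\|_v$. Let $\mathcal O\circ\mathcal H_v^\infty(U,F)$ be the set of all $f\in\mathcal H_v^\infty(U,F)$ of the form $f=S\circ g$ with $G$ a complex Banach space, $g\in\mathcal H_v^\infty(U,G)$ and $S\in\mathcal O(G,F)$, and let $\|f\|_{\mathcal O\circ\mathcal H_v^\infty}$ be the infimum of $\|S\|\,\|g\|_v$ over all such factorizations. Then, for every $f\in\mathcal H_v^\infty(U,F)$, the following are equivalent: (i) $f\in\mathcal H_{v\mathcal O}^\infty(U,F)$; (ii) $T_f\in\mathcal O(\mathcal G_v^\infty(U),F)$; (iii) $f\in\mathcal O\circ\mathcal H_v^\infty(U,F)$. In this case $$\|f\|_v=\|T_f\|=\|f\|_{\mathcal O\circ\mathcal H_v^\infty}.$$ In particular, $\mathcal H_{v\mathcal O}^\infty$ has the linearization property in $\mathcal O$: for every $f\in\mathcal H_v^\infty(U,F)$ one has $f\in\mathcal H_{v\mathcal O}^\infty(U,F)$ if and only if $T_f\in\mathcal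 O(\mathcal G_v^\infty(U),F)$, and then $\|f\|_v=\|T_f\|$. -/

import Mathlib

set_option maxSynthPendingDepth 3

open TopologicalSpace
open scoped ZeroAtInfty

universe u

noncomputable section

/-- A weight on an open set `U`: a strictly positive continuous function `U → ℝ`. -/
structure Weight {E : Type u} [NormedAddCommGroup E] (U : Opens E) where
  /-- the underlying function -/
  toFun : U → ℝ
  continuous_toFun : Continuous toFun
  pos : ∀ x, 0 < toFun x

instance {E : Type u} [NormedAddCommGroup E] (U : Opens E) :
    CoeFun (Weight U) (fun _ => U → ℝ) := ⟨Weight.toFun⟩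

/-- A mapping `f : U → F` on an open set `U` of a complex normed space is holomorphic when it is
complex (Fréchet) differentiable at each point of `U`; differentiability is expressed through
a function on the whole space that restricts to `f`. -/
def IsHolomorphic {E : Type u} [NormedAddCommGroup E] [NormedSpace ℂ E] (U : Opens E)
    {F : Type*} [NormedAddCommGroup F] [NormedSpace ℂ F] (f : U → F) : Prop :=
  ∃ g : E → F, DifferentiableOn ℂ g (U : Set E) ∧ ∀ x : U, g x = f x

section WeightedHol

variable {E : Type u} [NormedAddCommGroup E] [NormedSpace ℂ E] (U : Opens E) (v : Weight U)
variable (F : Type*) [NormedAddCommGroup F] [NormedSpace ℂ F]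

/-- The holomorphic maps `f : U → F` with `sup_{x ∈ U} v x * ‖f x‖ < ∞`, as a linear subspace of
all maps `U → F`. -/
def weightedHolSubmodule : Submodule ℂ (U → F) where
  carrier := {f | IsHolomorphic U f ∧ BddAbove (Set.range fun x => v x * ‖f x‖)}
  add_mem' := by
    rintro f g ⟨⟨f', hf', hff⟩, ⟨a, ha⟩⟩ ⟨⟨g', hg', hgg⟩, ⟨b, hb⟩⟩
    refine ⟨⟨f' + g', hf'.add hg', fun x => by simp [hff, hgg]⟩, ⟨a + b, ?_⟩⟩
    rintro _ ⟨x, rfl⟩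
    have h1 : v x * ‖f x‖ ≤ a := ha ⟨x, rfl⟩
    have h2 : v x * ‖g x‖ ≤ b := hb ⟨x, rfl⟩
    have h3 := mul_le_mul_of_nonneg_left (norm_add_le (f x) (g x)) (v.pos x).le
    simp only [Pi.add_apply]
    linarith
  zero_mem' := ⟨⟨0, differentiableOn_const 0, fun x => rfl⟩, ⟨0, by rintro _ ⟨x, rfl⟩; simp⟩⟩
  smul_mem' := by
    rintro c f ⟨⟨f', hf', hff⟩, ⟨a, ha⟩⟩
    refine ⟨⟨c • f', hf'.const_smul c, fun x => by simp [hff]⟩, ⟨‖c‖ * a, ?_⟩⟩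
    rintro _ ⟨x, rfl⟩
    have h1 : v x * ‖f x‖ ≤ a := ha ⟨x, rfl⟩
    have h2 := mul_le_mul_of_nonneg_left h1 (norm_nonneg c)
    simp only [Pi.smul_apply, norm_smul]
    linarith

/-- The space `H_v^∞(U, F)` of weighted holomorphic mappings. -/
def WeightedHol : Type _ := weightedHolSubmodule U v F

instance : AddCommGroup (WeightedHol U v F) :=
  inferInstanceAs (AddCommGroup (weightedHolSubmodule U v F))

instance : Module ℂ (WeightedHol U v F) :=
  inferInstanceAs (Module ℂ (weightedHolSubmodule U v F))

instance : FunLike (WeightedHol U v F) U F := ⟨Subtype.val, Subtype.val_injective⟩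

/-- The weighted supremum norm `‖f‖_v = sup_{x ∈ U} v x * ‖f x‖`. -/
instance : Norm (WeightedHol U v F) := ⟨fun f => ⨆ x : U, v x * ‖f x‖⟩

variable {U v F}

theorem WeightedHol.norm_def (f : WeightedHol U v F) : ‖f‖ = ⨆ x : U, v x * ‖f x‖ := rfl

theorem WeightedHol.le_norm (f : WeightedHol U v F) (x : U) : v x * ‖f x‖ ≤ ‖f‖ :=
  le_ciSup f.2.2 x

theorem WeightedHol.norm_le (f : WeightedHol U v F) {c : ℝ} (hc : 0 ≤ c)
    (h : ∀ x, v x * ‖f x‖ ≤ c) : ‖f‖ ≤ c :=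
  Real.iSup_le h hc

theorem WeightedHol.norm_nonneg' (f : WeightedHol U v F) : 0 ≤ ‖f‖ :=
  Real.iSup_nonneg fun x => mul_nonneg (v.pos x).le (norm_nonneg _)

variable (U v F)

theorem WeightedHol.core : NormedSpace.Core ℂ (WeightedHol U v F) where
  norm_nonneg := WeightedHol.norm_nonneg'
  norm_smul c f := by
    simp only [WeightedHol.norm_def]
    rw [Real.mul_iSup_of_nonneg (norm_nonneg c)]
    congr 1
    ext x
    have h : (c • f) x = c • f x := rfl
    rw [h, norm_smul, mul_left_comm]
  norm_triangle f g := by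
    refine (f + g).norm_le (add_nonneg f.norm_nonneg' g.norm_nonneg') fun x => ?_
    have h : (f + g) x = f x + g x := rfl
    rw [h]
    have h3 := mul_le_mul_of_nonneg_left (norm_add_le (f x) (g x)) (v.pos x).le
    have h1 := f.le_norm x
    have h2 := g.le_norm x
    linarith
  norm_eq_zero_iff f := by
    constructor
    · intro hf
      refine Subtype.ext (funext fun x => ?_)
      have h1 := f.le_norm x
      rw [hf] at h1
      have h2 : ‖f x‖ ≤ 0 := by
        by_contra h
        exact absurd h1 (not_le.mpr (mul_pos (v.pos x) (not_le.mp h)))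
      exact norm_le_zero_iff.mp h2
    · rintro rfl
      exact le_antisymm (WeightedHol.norm_le 0 le_rfl fun x => by
        have h : (0 : WeightedHol U v F) x = 0 := rfl
        simp [h]) (WeightedHol.norm_nonneg' _)

instance : NormedAddCommGroup (WeightedHol U v F) :=
  NormedAddCommGroup.ofCore (WeightedHol.core U v F)

instance : NormedSpace ℂ (WeightedHol U v F) := NormedSpace.ofCore (WeightedHol.core U v F)

variable {F}

/-- The evaluation functional `δ_x : h ↦ h x` on `H_v^∞(U) = H_v^∞(U, ℂ)`. -/
def evalFunctional (x : U) : StrongDual ℂ (WeightedHol U v ℂ) :=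
  LinearMap.mkContinuous
    { toFun := fun h => h x
      map_add' := fun _ _ => rfl
      map_smul' := fun _ _ => rfl } (v x)⁻¹ fun h => by
    have h1 := h.le_norm x
    rw [inv_mul_eq_div, le_div_iff₀ (v.pos x), mul_comm]
    exact h1

/-- The canonical predual `G_v^∞(U)`: the norm-closed linear span of the evaluation functionals
in the dual space `H_v^∞(U)^*`, with the dual norm. -/
def weightedPredual : Submodule ℂ (StrongDual ℂ (WeightedHol U v ℂ)) :=
  (Submodule.span ℂ (Set.range (evalFunctional U v))).topologicalClosure

/-- The map `Δ_v : U → G_v^∞(U)`, `x ↦ δ_x`. -/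
def evalMap (x : U) : weightedPredual U v :=
  ⟨evalFunctional U v x, Submodule.le_topologicalClosure _ (Submodule.subset_span ⟨x, rfl⟩)⟩

variable {U v}

/-- The composition `y ∘ f` of a weighted holomorphic map with a bounded linear functional `y`. -/
def dualComp (f : WeightedHol U v F) (y : StrongDual ℂ F) : WeightedHol U v ℂ :=
  ⟨fun x => y (f x), by
    obtain ⟨g, hg, hgf⟩ := f.2.1
    refine ⟨⟨fun x => y (g x), y.differentiable.comp_differentiableOn hg, fun x => ?_⟩,
      ⟨‖y‖ * ‖f‖, ?_⟩⟩
    · exact congrArg y (hgf x)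
    · rintro _ ⟨x, rfl⟩
      calc v x * ‖y (f x)‖ ≤ v x * (‖y‖ * ‖f x‖) :=
            mul_le_mul_of_nonneg_left (y.le_opNorm _) (v.pos x).le
        _ = ‖y‖ * (v x * ‖f x‖) := by ring
        _ ≤ ‖y‖ * ‖f‖ := mul_le_mul_of_nonneg_left (f.le_norm x) (norm_nonneg _)⟩

theorem norm_dualComp_le (f : WeightedHol U v F) (y : StrongDual ℂ F) :
    ‖dualComp f y‖ ≤ ‖f‖ * ‖y‖ := by
  refine (dualComp f y).norm_le (mul_nonneg (norm_nonneg _) (norm_nonneg _)) fun x => ?_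
  calc v x * ‖y (f x)‖ ≤ v x * (‖y‖ * ‖f x‖) :=
        mul_le_mul_of_nonneg_left (y.le_opNorm _) (v.pos x).le
    _ = (v x * ‖f x‖) * ‖y‖ := by ring
    _ ≤ ‖f‖ * ‖y‖ := mul_le_mul_of_nonneg_right (f.le_norm x) (norm_nonneg _)

/-- `y ↦ y ∘ f` as a bounded linear map `F^* → H_v^∞(U)`. -/
def dualCompCLM (f : WeightedHol U v F) : StrongDual ℂ F →L[ℂ] WeightedHol U v ℂ :=
  LinearMap.mkContinuous
    { toFun := dualComp f
      map_add' := fun _ _ => rfl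
      map_smul' := fun _ _ => rfl } ‖f‖ (norm_dualComp_le f)

/-- Every weighted holomorphic map factors uniquely through `Δ_v` by a bounded linear operator. -/
theorem existsUnique_linearization [CompleteSpace F] (f : WeightedHol U v F) :
    ∃! T : weightedPredual U v →L[ℂ] F, ∀ x : U, T (evalMap U v x) = f x := by
  let Φ : StrongDual ℂ (WeightedHol U v ℂ) →L[ℂ] StrongDual ℂ (StrongDual ℂ F) :=
    (ContinuousLinearMap.compL ℂ (StrongDual ℂ F) (WeightedHol U v ℂ) ℂ).flip (dualCompCLM f)
  let J := NormedSpace.inclusionInDoubleDualLi (E := F) ℂ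
  have hΦδ : ∀ x, Φ (evalFunctional U v x) = J (f x) := fun x => rfl
  have hclosed : IsClosed (LinearMap.range J.toLinearMap : Set (StrongDual ℂ (StrongDual ℂ F))) := by
    rw [LinearMap.coe_range]
    exact J.isometry.isUniformInducing.isComplete_range.isClosed
  have hmem : ∀ φ : weightedPredual U v, Φ φ ∈ LinearMap.range J.toLinearMap := by
    have hle : weightedPredual U v ≤ (LinearMap.range J.toLinearMap).comap Φ.toLinearMap := by
      refine Submodule.topologicalClosure_minimal _ (Submodule.span_le.mpr ?_)
        (hclosed.preimage Φ.continuous)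
      rintro _ ⟨x, rfl⟩
      exact ⟨f x, (hΦδ x).symm⟩
    exact fun φ => hle φ.2
  choose T hT using hmem
  have hJ : ∀ φ, J (T φ) = Φ φ := hT
  let T : weightedPredual U v →L[ℂ] F := LinearMap.mkContinuous
    { toFun := T
      map_add' := fun a b => J.injective (by rw [map_add, hJ, hJ, hJ, Submodule.coe_add, map_add])
      map_smul' := fun c a => J.injective (by
        rw [map_smul, hJ, hJ, Submodule.coe_smul, map_smul, RingHom.id_apply]) } ‖Φ‖ fun φ => by
    rw [← J.norm_map]
    exact (congrArg norm (hJ φ)).le.trans (Φ.le_opNorm φ)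
  have hT : ∀ x : U, T (evalMap U v x) = f x :=
    fun x => J.injective ((hJ (evalMap U v x)).trans (hΦδ x))
  refine ⟨T, hT, fun S hS => ?_⟩
  have hdense : ∀ (φ : StrongDual ℂ (WeightedHol U v ℂ)) (h : φ ∈ weightedPredual U v),
      S ⟨φ, h⟩ = T ⟨φ, h⟩ := by
    have hcl : IsClosed {z : weightedPredual U v | S z = T z} :=
      isClosed_eq S.continuous T.continuous
    have hspan : ∀ (φ : StrongDual ℂ (WeightedHol U v ℂ))
        (h : φ ∈ Submodule.span ℂ (Set.range (evalFunctional U v))),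
        S ⟨φ, Submodule.le_topologicalClosure _ h⟩ =
          T ⟨φ, Submodule.le_topologicalClosure _ h⟩ := by
      intro φ h
      induction h using Submodule.span_induction with
      | mem φ h =>
        obtain ⟨x, rfl⟩ := h
        exact (hS x).trans (hT x).symm
      | zero => exact (map_zero S).trans (map_zero T).symm
      | add a b ha hb iha ihb =>
        exact (map_add S ⟨a, _⟩ ⟨b, _⟩).trans
          ((congrArg₂ (· + ·) iha ihb).trans (map_add T ⟨a, _⟩ ⟨b, _⟩).symm)
      | smul c a ha iha =>
        exact (map_smul S c ⟨a, _⟩).trans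
          ((congrArg (c • ·) iha).trans (map_smul T c ⟨a, _⟩).symm)
    intro φ h
    have h2 : (⟨φ, h⟩ : weightedPredual U v) ∈ closure {z : weightedPredual U v | S z = T z} := by
      rw [Topology.IsInducing.subtypeVal.closure_eq_preimage_closure_image]
      refine closure_mono ?_ h
      intro ψ hψ
      exact ⟨⟨ψ, Submodule.le_topologicalClosure _ hψ⟩, hspan ψ hψ, rfl⟩
    exact hcl.closure_subset h2
  exact ContinuousLinearMap.ext fun z => hdense z.1 z.2

/-- The linearization `T_f : G_v^∞(U) → F` of `f`: the unique bounded linear operator with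
`T_f ∘ Δ_v = f`. -/
def linearization [CompleteSpace F] (f : WeightedHol U v F) : weightedPredual U v →L[ℂ] F :=
  (existsUnique_linearization f).choose

end WeightedHol

/-- A set `A` in a normed space is relatively weakly compact if its closure in the weak topology is
weakly compact. -/
def IsRelativelyWeaklyCompact {X : Type*} [NormedAddCommGroup X] [NormedSpace ℂ X]
    (A : Set X) : Prop :=
  IsCompact (closure (toWeakSpace ℂ X '' A))

/-- `K ⊆ X` is a Grothendieck set if `T(K)` is relatively weakly compact in `c₀` for each bounded
linear operator `T : X → c₀`; here `c₀` is the space `C₀(ℕ, ℂ)` of complex null sequences with the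
supremum norm. -/
def IsGrothendieckSet {X : Type*} [NormedAddCommGroup X] [NormedSpace ℂ X] (K : Set X) : Prop :=
  ∀ T : X →L[ℂ] C₀(ℕ, ℂ), IsRelativelyWeaklyCompact (T '' K)

/-- The component `O(X, Y)` of the ideal of Grothendieck operators: those bounded linear operators
that map the closed unit ball to a Grothendieck set. Its norm is the operator norm. -/
def grothendieckOperators (X Y : Type*) [NormedAddCommGroup X] [NormedSpace ℂ X]
    [NormedAddCommGroup Y] [NormedSpace ℂ Y] : Set (X →L[ℂ] Y) :=
  {T | IsGrothendieckSet (T '' Metric.closedBall 0 1)}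

section Ideals

variable {E : Type u} [NormedAddCommGroup E] [NormedSpace ℂ E] (U : Opens E) (v : Weight U)
variable (F : Type u) [NormedAddCommGroup F] [NormedSpace ℂ F]

/-- The space `H_{vO}^∞(U, F)` of Grothendieck weighted holomorphic maps: those for which
`(v f)(U) = {v x • f x : x ∈ U}` is a Grothendieck set. Its norm is `‖·‖_v`. -/
def grothendieckWeightedHol : Set (WeightedHol U v F) :=
  {f | IsGrothendieckSet (Set.range fun x : U => (v x : ℂ) • f x)}

variable {U v F}

/-- `f = S ∘ g` with `G` a complex Banach space, `g ∈ H_v^∞(U, G)` and `S ∈ O(G, F)`. -/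
def IsGrothendieckFactorization (f : WeightedHol U v F) (G : Type u) [NormedAddCommGroup G]
    [NormedSpace ℂ G] (S : G →L[ℂ] F) (g : WeightedHol U v G) : Prop :=
  S ∈ grothendieckOperators G F ∧ ∀ x : U, f x = S (g x)

variable (U v F)

/-- The composition ideal `O ∘ H_v^∞(U, F)`. -/
def grothendieckComposition : Set (WeightedHol U v F) :=
  {f | ∃ (G : Type u) (_ : NormedAddCommGroup G) (_ : NormedSpace ℂ G) (_ : CompleteSpace G)
    (S : G →L[ℂ] F) (g : WeightedHol U v G), IsGrothendieckFactorization f G S g}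

variable {U v F}

/-- The composition norm: the infimum of `‖S‖ * ‖g‖_v` over all factorizations `f = S ∘ g` as in
the definition of `O ∘ H_v^∞(U, F)`. -/
def grothendieckCompositionNorm (f : WeightedHol U v F) : ℝ :=
  sInf {r | ∃ (G : Type u) (_ : NormedAddCommGroup G) (_ : NormedSpace ℂ G) (_ : CompleteSpace G)
    (S : G →L[ℂ] F) (g : WeightedHol U v G),
    IsGrothendieckFactorization f G S g ∧ r = ‖S‖ * ‖g‖}

/-- The linearization property of a class `I` of weighted holomorphic maps with norm `normI` in
a class `A` of bounded linear operators with norm `normA` (the components at `U`, `v`, `F`):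
`f` is in `I` iff `T_f` is in `A`, and then the norm of `f` in `I` is the norm of `T_f` in `A`. -/
def HasLinearizationProperty [CompleteSpace F]
    (I : Set (WeightedHol U v F)) (normI : WeightedHol U v F → ℝ)
    (A : Set (weightedPredual U v →L[ℂ] F)) (normA : (weightedPredual U v →L[ℂ] F) → ℝ) : Prop :=
  ∀ f : WeightedHol U v F,
    (f ∈ I ↔ linearization f ∈ A) ∧ (f ∈ I → normI f = normA (linearization f))

end Ideals

end

/-!
The identity `f = T_f ∘ Δ_v`, with `Δ_v : x ↦ δ_x`, links the three conditions.

If `f` is Grothendieck, let `T : F → c₀` be bounded and put `A = T((v f)(U))`, which is relatively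
weakly compact. A functional `φ` on `c₀` with `|φ| ≤ s` on `A` satisfies `‖φ ∘ T ∘ f‖_v ≤ s`, and
`φ(T(T_f g)) = g(φ ∘ T ∘ f)` for `g ∈ G_v^∞(U)` (`apply_linearization`). Hence `T ∘ T_f` maps the
unit ball into the absolute bipolar of `A`. That this bipolar is again weakly compact is Krein's
theorem, proved here for `c₀` (`IsRelativelyWeaklyCompact.of_norm_apply_le`): with `K` the weak
closure of `A ∪ {0}`, every probability measure on `𝕋 × K` has a barycentre with respect to
`(c, x) ↦ c x`. Taken coordinatewise it is a null sequence, by dominated convergence, and it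
depends continuously on the measure for the weak topologies. The set of these barycentres is
therefore convex and weakly compact, and the Hahn-Banach theorem places the bipolar inside it.

If `T_f` is a Grothendieck operator, then `f = T_f ∘ Δ_v` is a factorization of the required kind,
once `Δ_v` is known to be holomorphic (`isHolomorphic_evalMap`). This follows from the Taylor
estimate `‖h x - h x₀ - h'(x₀)(x - x₀)‖ ≤ C ‖h‖_v ‖x - x₀‖²`, which is uniform in `h`.

If `f = S ∘ g` with `S` Grothendieck, then `(v f)(U)` lies in a multiple of the image of the unit
ball under `S`.

The equality `‖T_f‖ = ‖f‖_v` comes from the same duality formula, and the composition norm lies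
between `‖f‖_v` and `‖T_f‖ ‖Δ_v‖_v ≤ ‖T_f‖`.
-/

open Filter Topology MeasureTheory Metric Asymptotics

/-! ### Relatively weakly compact sets -/

namespace IsRelativelyWeaklyCompact

variable {X Y : Type*} [NormedAddCommGroup X] [NormedSpace ℂ X] [NormedAddCommGroup Y]
  [NormedSpace ℂ Y]

theorem mono {A B : Set X} (hB : IsRelativelyWeaklyCompact B) (h : A ⊆ B) :
    IsRelativelyWeaklyCompact A :=
  IsCompact.of_isClosed_subset hB isClosed_closure (closure_mono (Set.image_mono h))

theorem of_subset_isCompact {A : Set X} {B : Set (WeakSpace ℂ X)} (hB : IsCompact B)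
    (h : ∀ a ∈ A, toWeakSpace ℂ X a ∈ B) : IsRelativelyWeaklyCompact A :=
  hB.closure_of_subset (by rintro _ ⟨a, ha, rfl⟩; exact h a ha)

theorem image {A : Set X} (hA : IsRelativelyWeaklyCompact A) (T : X →L[ℂ] Y) :
    IsRelativelyWeaklyCompact (T '' A) := by
  refine of_subset_isCompact (IsCompact.image (f := WeakSpace.map T) hA (WeakSpace.map T).continuous) ?_
  rintro _ ⟨a, ha, rfl⟩
  exact ⟨toWeakSpace ℂ X a, subset_closure ⟨a, ha, rfl⟩, rfl⟩

theorem insert_zero {A : Set X} (hA : IsRelativelyWeaklyCompact A) :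
    IsRelativelyWeaklyCompact (insert 0 A) := by
  refine of_subset_isCompact (hA.insert 0) ?_
  rintro a (rfl | ha)
  · exact Or.inl (map_zero _)
  · exact Or.inr (subset_closure ⟨a, ha, rfl⟩)

end IsRelativelyWeaklyCompact

/-! ### Truncation in `c₀` -/

/-- The `n`-th unit vector of `c₀`. -/
noncomputable def nullSeqSingle (n : ℕ) : C₀(ℕ, ℂ) where
  toFun := Pi.single n 1
  continuous_toFun := continuous_of_discreteTopology
  zero_at_infty' := by
    rw [cocompact_eq_cofinite, Nat.cofinite_eq_atTop]
    refine tendsto_const_nhds.congr' ?_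
    filter_upwards [eventually_gt_atTop n] with m hm
    simp [hm.ne']

/-- The partial sum `∑_{n < N} x n • e n` of the unit vector expansion of `x ∈ c₀`. -/
noncomputable def nullSeqTrunc (N : ℕ) (x : C₀(ℕ, ℂ)) : C₀(ℕ, ℂ) :=
  ∑ n ∈ Finset.range N, x n • nullSeqSingle n

theorem nullSeqTrunc_apply (N : ℕ) (x : C₀(ℕ, ℂ)) (m : ℕ) :
    nullSeqTrunc N x m = if m < N then x m else 0 := by
  have h : ∀ s : Finset ℕ, (∑ n ∈ s, x n • nullSeqSingle n) m = if m ∈ s then x m else 0 := by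
    intro s
    induction s using Finset.induction_on with
    | empty => simp
    | insert a s ha ih =>
      have h1 : nullSeqSingle a m = if m = a then 1 else 0 := by
        simp [nullSeqSingle, Pi.single_apply]
      rw [Finset.sum_insert ha, ZeroAtInftyContinuousMap.add_apply, ih,
        ZeroAtInftyContinuousMap.smul_apply, h1]
      by_cases hm : m = a
      · subst hm; simp [ha]
      · simp [hm]
  simp only [nullSeqTrunc, h, Finset.mem_range]

theorem nullSeq_norm_le {x : C₀(ℕ, ℂ)} {C : ℝ} (hC : 0 ≤ C) (h : ∀ n, ‖x n‖ ≤ C) : ‖x‖ ≤ C := by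
  rw [← ZeroAtInftyContinuousMap.norm_toBCF_eq_norm]
  exact (BoundedContinuousFunction.norm_le hC).2 h

theorem nullSeq_norm_apply_le (x : C₀(ℕ, ℂ)) (n : ℕ) : ‖x n‖ ≤ ‖x‖ := by
  rw [← ZeroAtInftyContinuousMap.norm_toBCF_eq_norm]
  exact x.toBCF.norm_coe_le_norm n

theorem nullSeq_tendsto_zero (x : C₀(ℕ, ℂ)) : Tendsto x atTop (𝓝 0) := by
  have h := x.zero_at_infty'
  rw [cocompact_eq_cofinite, Nat.cofinite_eq_atTop] at h
  exact h

theorem norm_nullSeqTrunc_le (N : ℕ) (x : C₀(ℕ, ℂ)) : ‖nullSeqTrunc N x‖ ≤ ‖x‖ := by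
  refine nullSeq_norm_le (norm_nonneg _) fun n => ?_
  rw [nullSeqTrunc_apply]
  split_ifs
  · exact nullSeq_norm_apply_le x n
  · simp

theorem tendsto_nullSeqTrunc (x : C₀(ℕ, ℂ)) :
    Tendsto (fun N => nullSeqTrunc N x) atTop (𝓝 x) := by
  rw [Metric.tendsto_atTop]
  intro ε hε
  obtain ⟨N₀, hN₀⟩ := Metric.tendsto_atTop.1 (nullSeq_tendsto_zero x) (ε / 2) (half_pos hε)
  refine ⟨N₀, fun N hN => ?_⟩
  rw [dist_eq_norm]
  refine (nullSeq_norm_le (half_pos hε).le fun n => ?_).trans_lt (half_lt_self hε)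
  rw [ZeroAtInftyContinuousMap.sub_apply, nullSeqTrunc_apply]
  split_ifs with h
  · simpa using (half_pos hε).le
  · simpa using (hN₀ n (by omega)).le

/-! ### Barycentres in `c₀` -/

theorem continuous_nullSeq_apply {Q : Type*} [TopologicalSpace Q] {τ : Q → C₀(ℕ, ℂ)}
    (hτ : ∀ φ : StrongDual ℂ C₀(ℕ, ℂ), Continuous fun q => φ (τ q)) (n : ℕ) :
    Continuous fun q => τ q n :=
  hτ (LinearMap.mkContinuous
    { toFun := fun x => x n
      map_add' := fun _ _ => rfl
      map_smul' := fun _ _ => rfl } 1 fun x => by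
    simpa using nullSeq_norm_apply_le x n)

theorem continuous_integrable {Q : Type*} [TopologicalSpace Q] [CompactSpace Q]
    [MeasurableSpace Q] [BorelSpace Q] {g : Q → ℂ} (hg : Continuous g) (μ : Measure Q)
    [IsFiniteMeasure μ] : Integrable g μ :=
  hg.integrable_of_hasCompactSupport (HasCompactSupport.of_compactSpace g)

section Barycenter

variable {Q : Type*} [TopologicalSpace Q] [CompactSpace Q]

/-- By the uniform boundedness principle, a weakly continuous map on a compact space is bounded. -/
theorem exists_norm_le_of_weakly_continuous {X : Type*} [NormedAddCommGroup X] [NormedSpace ℂ X]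
    {τ : Q → X} (hτ : ∀ φ : StrongDual ℂ X, Continuous fun q => φ (τ q)) :
    ∃ M, ∀ q, ‖τ q‖ ≤ M := by
  obtain ⟨M, hM⟩ := banach_steinhaus
    (g := fun q : Q => NormedSpace.inclusionInDoubleDualLi (E := X) ℂ (τ q)) (fun φ => by
      obtain ⟨C, hC⟩ := isCompact_univ.exists_bound_of_continuousOn (hτ φ).continuousOn
      exact ⟨C, fun q => hC q trivial⟩)
  exact ⟨M, fun q => by simpa using hM q⟩

variable [MeasurableSpace Q] [BorelSpace Q] {τ : Q → C₀(ℕ, ℂ)}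

/-- The barycentre of the image of `μ` under a weakly continuous `τ : Q → c₀`, computed
coordinatewise. It is a null sequence by dominated convergence. -/
noncomputable def nullSeqBarycenter
    (hτ : ∀ φ : StrongDual ℂ C₀(ℕ, ℂ), Continuous fun q => φ (τ q)) (μ : ProbabilityMeasure Q) :
    C₀(ℕ, ℂ) where
  toFun := fun n => ∫ q, τ q n ∂(μ : Measure Q)
  continuous_toFun := continuous_of_discreteTopology
  zero_at_infty' := by
    rw [cocompact_eq_cofinite, Nat.cofinite_eq_atTop]
    obtain ⟨M, hM⟩ := exists_norm_le_of_weakly_continuous hτ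
    have h := tendsto_integral_of_dominated_convergence (μ := (μ : Measure Q))
      (F := fun n q => τ q n) (f := fun _ => 0) (fun _ => M)
      (fun n => (continuous_integrable (continuous_nullSeq_apply hτ n) _).1)
      (integrable_const M)
      (fun n => .of_forall fun q => (nullSeq_norm_apply_le _ n).trans (hM q))
      (.of_forall fun q => nullSeq_tendsto_zero (τ q))
    simpa using h

/-- The coordinatewise barycentre is the Pettis integral of `τ`: approximate by truncations and
pass to the limit under the integral sign. -/
theorem apply_nullSeqBarycenter
    (hτ : ∀ φ : StrongDual ℂ C₀(ℕ, ℂ), Continuous fun q => φ (τ q)) (μ : ProbabilityMeasure Q)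
    (φ : StrongDual ℂ C₀(ℕ, ℂ)) :
    φ (nullSeqBarycenter hτ μ) = ∫ q, φ (τ q) ∂(μ : Measure Q) := by
  obtain ⟨M, hM⟩ := exists_norm_le_of_weakly_continuous hτ
  have htr : ∀ (N : ℕ) (x : C₀(ℕ, ℂ)),
      φ (nullSeqTrunc N x) = ∑ n ∈ Finset.range N, x n * φ (nullSeqSingle n) := fun N x => by
    simp [nullSeqTrunc, map_sum]
  have hcont : ∀ N, Continuous fun q => φ (nullSeqTrunc N (τ q)) := fun N => by
    simp only [htr]
    exact continuous_finsetSum _ fun n _ => (continuous_nullSeq_apply hτ n).mul continuous_const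
  have h1 : Tendsto (fun N => ∫ q, φ (nullSeqTrunc N (τ q)) ∂(μ : Measure Q)) atTop
      (𝓝 (∫ q, φ (τ q) ∂(μ : Measure Q))) := by
    refine tendsto_integral_of_dominated_convergence (fun _ => ‖φ‖ * M)
      (fun N => (continuous_integrable (hcont N) _).1) (integrable_const _)
      (fun N => .of_forall fun q => ?_)
      (.of_forall fun q => (φ.continuous.tendsto _).comp (tendsto_nullSeqTrunc (τ q)))
    exact (φ.le_opNorm _).trans (mul_le_mul_of_nonneg_left
      ((norm_nullSeqTrunc_le N _).trans (hM q)) (norm_nonneg _))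
  have h2 : ∀ N, ∫ q, φ (nullSeqTrunc N (τ q)) ∂(μ : Measure Q) =
      φ (nullSeqTrunc N (nullSeqBarycenter hτ μ)) := fun N => by
    simp only [htr]
    rw [integral_finsetSum _ fun n _ =>
      (continuous_integrable (continuous_nullSeq_apply hτ n) _).mul_const _]
    exact Finset.sum_congr rfl fun n _ => integral_mul_const _ _
  simp only [h2] at h1
  exact tendsto_nhds_unique ((φ.continuous.tendsto _).comp (tendsto_nullSeqTrunc _)) h1

theorem continuous_toWeakSpace_nullSeqBarycenter
    (hτ : ∀ φ : StrongDual ℂ C₀(ℕ, ℂ), Continuous fun q => φ (τ q)) :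
    Continuous fun μ : ProbabilityMeasure Q => toWeakSpace ℂ _ (nullSeqBarycenter hτ μ) := by
  refine WeakBilin.continuous_of_continuous_eval _ fun φ => ?_
  change Continuous fun μ : ProbabilityMeasure Q => φ (nullSeqBarycenter hτ μ)
  simp only [apply_nullSeqBarycenter]
  refine continuous_iff_continuousAt.2 fun μ => ?_
  exact (ProbabilityMeasure.tendsto_iff_forall_integral_rclike_tendsto ℂ).1 tendsto_id
    (BoundedContinuousFunction.mkOfCompact ⟨_, hτ φ⟩)

theorem nullSeqBarycenter_diracProba
    (hτ : ∀ φ : StrongDual ℂ C₀(ℕ, ℂ), Continuous fun q => φ (τ q)) (q : Q) :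
    nullSeqBarycenter hτ (diracProba q) = τ q := by
  ext n
  change ∫ q, τ q n ∂(Measure.dirac q) = _
  exact integral_dirac' _ _ (continuous_nullSeq_apply hτ n).stronglyMeasurable

theorem convex_range_nullSeqBarycenter
    (hτ : ∀ φ : StrongDual ℂ C₀(ℕ, ℂ), Continuous fun q => φ (τ q)) :
    Convex ℝ (Set.range (nullSeqBarycenter hτ)) := by
  rintro _ ⟨μ, rfl⟩ _ ⟨ν, rfl⟩ a b ha hb hab
  lift a to NNReal using ha
  lift b to NNReal using hb
  have hab' : a + b = 1 := by exact_mod_cast hab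
  refine ⟨⟨a • (μ : Measure Q) + b • (ν : Measure Q), ⟨?_⟩⟩, ?_⟩
  · simp only [Measure.add_apply, Measure.smul_apply, measure_univ]
    simp only [ENNReal.smul_def, smul_eq_mul, mul_one]
    exact_mod_cast hab'
  · ext n
    have hi := continuous_nullSeq_apply hτ n
    change ∫ q, τ q n ∂(a • (μ : Measure Q) + b • (ν : Measure Q)) =
      (a : ℝ) • ∫ q, τ q n ∂(μ : Measure Q) + (b : ℝ) • ∫ q, τ q n ∂(ν : Measure Q)
    rw [integral_add_measure (continuous_integrable hi _) (continuous_integrable hi _),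
      integral_smul_nnreal_measure, integral_smul_nnreal_measure]
    rfl

end Barycenter

/-- The weak form of Krein's theorem for `c₀` that is needed: if `A` is relatively weakly compact,
so is every set lying in the absolute bipolar of `A`. -/
theorem IsRelativelyWeaklyCompact.of_norm_apply_le {A D : Set C₀(ℕ, ℂ)}
    (hA : IsRelativelyWeaklyCompact A)
    (hD : ∀ (φ : StrongDual ℂ C₀(ℕ, ℂ)) (s : ℝ), 0 ≤ s → (∀ a ∈ A, ‖φ a‖ ≤ s) →
      ∀ d ∈ D, ‖φ d‖ ≤ s) :
    IsRelativelyWeaklyCompact D := by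
  -- Adjoining `0` makes `K` nonempty and the bound `s` below positive, even if `A` is empty.
  set K : Set (WeakSpace ℂ C₀(ℕ, ℂ)) := closure (toWeakSpace ℂ _ '' insert 0 A) with hKdef
  have hK : IsCompact K := hA.insert_zero
  have hmem : ∀ a ∈ insert 0 A, toWeakSpace ℂ _ a ∈ K := fun a ha => subset_closure ⟨a, ha, rfl⟩
  have : CompactSpace K := isCompact_iff_compactSpace.1 hK
  let Q := Circle × K
  let : MeasurableSpace Q := borel Q
  have : BorelSpace Q := ⟨rfl⟩
  let τ : Q → C₀(ℕ, ℂ) := fun q => (q.1 : ℂ) • (toWeakSpace ℂ _).symm (q.2 : WeakSpace ℂ C₀(ℕ, ℂ))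
  have hτ : ∀ φ : StrongDual ℂ C₀(ℕ, ℂ), Continuous fun q => φ (τ q) := fun φ => by
    have h1 : Continuous fun x : WeakSpace ℂ C₀(ℕ, ℂ) => φ ((toWeakSpace ℂ _).symm x) :=
      WeakBilin.eval_continuous _ φ
    have h2 : (fun q => φ (τ q)) =
        fun q : Q => (q.1 : ℂ) * φ ((toWeakSpace ℂ _).symm (q.2 : WeakSpace ℂ C₀(ℕ, ℂ))) := by
      funext q; simp [τ]
    rw [h2]
    exact ((continuous_subtype_val : Continuous fun z : Circle => (z : ℂ)).comp continuous_fst).mul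
      (h1.comp (continuous_subtype_val.comp continuous_snd))
  set B := Set.range (nullSeqBarycenter hτ) with hBdef
  have hBc : IsCompact (toWeakSpace ℂ _ '' B) := by
    rw [hBdef, ← Set.range_comp]
    exact isCompact_range (continuous_toWeakSpace_nullSeqBarycenter hτ)
  have hBclosed : IsClosed B := by
    have h := hBc.isClosed.preimage (toWeakSpaceCLM ℂ C₀(ℕ, ℂ)).continuous
    convert h using 1
    exact ((toWeakSpace ℂ C₀(ℕ, ℂ)).injective.preimage_image B).symm
  have hBmem : ∀ (c : Circle), ∀ a ∈ insert 0 A, (c : ℂ) • a ∈ B := fun c a ha =>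
    ⟨diracProba (c, ⟨_, hmem a ha⟩), nullSeqBarycenter_diracProba hτ _⟩
  refine .of_subset_isCompact hBc fun d hd => ⟨d, ?_, rfl⟩
  by_contra hdB
  obtain ⟨φ, s, hφ, hs⟩ := RCLike.geometric_hahn_banach_closed_point (𝕜 := ℂ)
    (convex_range_nullSeqBarycenter hτ) hBclosed hdB
  have hs0 : 0 < s := by
    simpa using hφ _ (hBmem 1 0 (Set.mem_insert _ _))
  refine absurd (hD φ s hs0.le (fun a ha => ?_) d hd)
    (not_le.2 (hs.trans_le (Complex.re_le_norm _)))
  rcases eq_or_ne (φ a) 0 with h0 | h0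
  · simpa [h0] using hs0.le
  -- Rotate `a` so that `φ` takes the value `‖φ a‖` on it.
  · have hz : ‖(‖φ a‖ : ℂ) / φ a‖ = 1 := by simp [h0]
    have h := hφ _ (hBmem ⟨(‖φ a‖ : ℂ) / φ a, mem_sphere_zero_iff_norm.2 hz⟩ a
      (Set.mem_insert_of_mem _ ha))
    have h3 : φ (((‖φ a‖ : ℂ) / φ a) • a) = (‖φ a‖ : ℂ) := by
      rw [map_smul, smul_eq_mul, div_mul_cancel₀ _ h0]
    change RCLike.re (φ (((‖φ a‖ : ℂ) / φ a) • a)) < s at h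
    rw [h3] at h
    simpa using h.le

/-! ### Cauchy estimates -/

section Cauchy

variable {E F : Type*} [NormedAddCommGroup E] [NormedSpace ℂ E] [NormedAddCommGroup F]
  [NormedSpace ℂ F] {f : E → F} {c z : E} {R M : ℝ}

theorem norm_fderiv_le_of_norm_le_ball (hR : 0 < R) (hd : DifferentiableOn ℂ f (ball c R))
    (hM : ∀ w ∈ ball c R, ‖f w‖ ≤ M) : ‖fderiv ℂ f c‖ ≤ 2 * M / R := by
  refine Complex.norm_fderiv_le_div_of_mapsTo_ball hd (fun w hw => ?_) hR
  rw [mem_closedBall, dist_eq_norm]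
  linarith [norm_sub_le (f w) (f c), hM w hw, hM c (mem_ball_self hR)]

/-- Second-order Taylor estimate: the remainder vanishes to second order at `c` and is bounded by
`4 * M` on the ball, so the Schwarz lemma applies to it. -/
theorem norm_sub_sub_fderiv_le_of_norm_le_ball (hR : 0 < R) (hd : DifferentiableOn ℂ f (ball c R))
    (hM : ∀ w ∈ ball c R, ‖f w‖ ≤ M) (hz : z ∈ ball c R) :
    ‖f z - f c - fderiv ℂ f c (z - c)‖ ≤ 4 * M * (‖z - c‖ / R) ^ 2 := by
  have hdc : HasFDerivAt f (fderiv ℂ f c) c :=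
    (hd.differentiableAt (ball_mem_nhds c hR)).hasFDerivAt
  have h := Complex.dist_le_mul_div_pow_of_mapsTo_ball_of_isLittleO (n := 1) (R₂ := 4 * M)
    (f := fun w => f w - fderiv ℂ f c (w - c)) (c := c) (R₁ := R) (z := z)
    (hd.sub ((fderiv ℂ f c).differentiable.comp (differentiable_id.sub_const c)).differentiableOn)
    (fun w hw => ?_) ?_ hz
  · simpa [dist_eq_norm, sub_right_comm] using h
  · have h1 := (fderiv ℂ f c).le_of_opNorm_le (norm_fderiv_le_of_norm_le_ball hR hd hM) (w - c)
    have hM0 : 0 ≤ M := (norm_nonneg _).trans (hM c (mem_ball_self hR))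
    have h2 : 2 * M / R * ‖w - c‖ ≤ 2 * M / R * R :=
      mul_le_mul_of_nonneg_left (mem_ball_iff_norm.1 hw).le (by positivity)
    rw [div_mul_cancel₀ _ hR.ne'] at h2
    rw [mem_closedBall, dist_eq_norm]
    simp only [sub_self, map_zero, sub_zero]
    linarith [norm_sub_le (f w - fderiv ℂ f c (w - c)) (f c), norm_sub_le (f w)
      (fderiv ℂ f c (w - c)), hM w hw, hM c (mem_ball_self hR)]
  · have h1 := hdc.isLittleO.norm_right
    simpa [sub_right_comm] using h1

end Cauchy

/-! ### Holomorphy of the evaluation map -/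

open Classical in
/-- The extension by zero of a function on `U` to the whole space. -/
noncomputable def extendZero {E : Type*} [TopologicalSpace E] {U : Opens E} {F : Type*} [Zero F] (f : U → F)
    (x : E) : F :=
  if hx : x ∈ U then f ⟨x, hx⟩ else 0

theorem extendZero_coe {E : Type*} [TopologicalSpace E] {U : Opens E} {F : Type*} [Zero F]
    (f : U → F) (x : U) : extendZero f (x : E) = f x := by
  simp [extendZero]

section WeightedHol

variable {E : Type u} [NormedAddCommGroup E] [NormedSpace ℂ E] {U : Opens E} {v : Weight U}

theorem WeightedHol.differentiableOn_extendZero {F : Type*} [NormedAddCommGroup F]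
    [NormedSpace ℂ F] (f : WeightedHol U v F) : DifferentiableOn ℂ (extendZero f) (U : Set E) := by
  obtain ⟨g, hg, hgf⟩ := f.2.1
  refine hg.congr fun x hx => ?_
  rw [hgf ⟨x, hx⟩]
  exact extendZero_coe f ⟨x, hx⟩

/-- Near each point the evaluation functionals are uniformly bounded, since `v` is bounded away
from zero there. -/
theorem exists_ball_norm_extendZero_le (v : Weight U) (x₀ : U) :
    ∃ R > 0, ∃ C, 0 ≤ C ∧ ball (x₀ : E) R ⊆ U ∧
      ∀ h : WeightedHol U v ℂ, ∀ x ∈ ball (x₀ : E) R, ‖extendZero h x‖ ≤ C * ‖h‖ := by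
  have ho : IsOpen {x : U | v x₀ / 2 < v x} := isOpen_lt continuous_const v.continuous_toFun
  have ho' := U.isOpen.isOpenEmbedding_subtypeVal.isOpenMap _ ho
  obtain ⟨R, hR, hball⟩ := Metric.isOpen_iff.1 ho' x₀ ⟨x₀, half_lt_self (v.pos x₀), rfl⟩
  have hv := half_pos (v.pos x₀)
  refine ⟨R, hR, (v x₀ / 2)⁻¹, inv_nonneg.2 hv.le, fun x hx => ?_, fun h x hx => ?_⟩
  · obtain ⟨y, -, rfl⟩ := hball hx
    exact y.2
  · obtain ⟨y, hy, rfl⟩ := hball hx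
    rw [extendZero_coe, inv_mul_eq_div, le_div_iff₀ hv, mul_comm]
    exact (mul_le_mul_of_nonneg_right (le_of_lt hy) (norm_nonneg _)).trans (h.le_norm y)

theorem norm_evalFunctional_le (x : U) : ‖evalFunctional U v x‖ ≤ (v x)⁻¹ :=
  LinearMap.mkContinuous_norm_le _ (inv_nonneg.2 (v.pos x).le) _

/-- The derivative of `x ↦ δ_x` at `x₀` is `u ↦ (h ↦ h'(x₀) u)`: the Taylor estimate for `h` holds with a
constant proportional to `‖h‖_v`, which makes it an estimate in the dual norm. -/
theorem hasFDerivAt_extendZero_evalFunctional (v : Weight U) (x₀ : U) :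
    ∃ L : E →L[ℂ] StrongDual ℂ (WeightedHol U v ℂ),
      HasFDerivAt (extendZero (evalFunctional U v)) L (x₀ : E) := by
  obtain ⟨R, hR, C, hC, hU, hbd⟩ := exists_ball_norm_extendZero_le v x₀
  have hd : ∀ h : WeightedHol U v ℂ, DifferentiableOn ℂ (extendZero h) (ball (x₀ : E) R) :=
    fun h => h.differentiableOn_extendZero.mono hU
  have hda : ∀ h : WeightedHol U v ℂ, DifferentiableAt ℂ (extendZero h) (x₀ : E) :=
    fun h => (hd h).differentiableAt (ball_mem_nhds _ hR)
  let L : E →L[ℂ] StrongDual ℂ (WeightedHol U v ℂ) := LinearMap.mkContinuous₂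
    (LinearMap.mk₂ ℂ (fun u (h : WeightedHol U v ℂ) => fderiv ℂ (extendZero h) (x₀ : E) u)
      (fun _ _ _ => map_add _ _ _) (fun _ _ _ => map_smul _ _ _)
      (fun u h k => by
        have : extendZero (h + k : WeightedHol U v ℂ) = extendZero h + extendZero (E := E) k := by
          funext x
          by_cases hx : x ∈ U
          · simp only [extendZero, hx, dif_pos, Pi.add_apply]; rfl
          · simp [extendZero, hx]
        rw [this, fderiv_add (hda h) (hda k)]; rfl)
      (fun c u h => by
        have : extendZero (c • h : WeightedHol U v ℂ) = c • extendZero (E := E) h := by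
          funext x
          by_cases hx : x ∈ U
          · simp only [extendZero, hx, dif_pos, Pi.smul_apply]; rfl
          · simp [extendZero, hx]
        rw [this, fderiv_const_smul (hda h)]; rfl)) (2 * C / R) (fun u h => by
        refine ((fderiv ℂ (extendZero h) (x₀ : E)).le_of_opNorm_le
          (norm_fderiv_le_of_norm_le_ball hR (hd h) (hbd h)) u).trans_eq ?_
        ring)
  refine ⟨L, .of_isLittleO ?_⟩
  have hO : (fun x => extendZero (evalFunctional U v) x - extendZero (evalFunctional U v) (x₀ : E) -
      L (x - x₀)) =O[nhds (x₀ : E)] fun x => ‖x - (x₀ : E)‖ ^ 2 := by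
    refine IsBigO.of_bound (4 * C / R ^ 2) ?_
    filter_upwards [ball_mem_nhds (x₀ : E) hR] with x hx
    refine ContinuousLinearMap.opNorm_le_bound _ (by positivity) fun h => ?_
    have h1 := norm_sub_sub_fderiv_le_of_norm_le_ball hR (hd h) (hbd h) hx
    have h2 : ∀ y ∈ U, extendZero (evalFunctional U v) y h = extendZero h y := fun y hy => by
      simp only [extendZero, hy, dif_pos]; rfl
    change ‖extendZero (evalFunctional U v) x h - extendZero (evalFunctional U v) (x₀ : E) h -
      fderiv ℂ (extendZero h) (x₀ : E) (x - x₀)‖ ≤ _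
    rw [h2 _ (hU hx), h2 _ x₀.2]
    refine h1.trans_eq ?_
    rw [norm_pow, norm_norm]
    field_simp
  refine hO.trans_isLittleO ?_
  have h3 : (fun x : E => ‖x - (x₀ : E)‖ ^ 2) =o[nhds (x₀ : E)] fun x => ‖x - (x₀ : E)‖ ^ 1 := by
    have h4 : Filter.Tendsto (fun x : E => ‖x - (x₀ : E)‖) (nhds (x₀ : E)) (nhds 0) := by
      have : Continuous fun x : E => ‖x - (x₀ : E)‖ := by fun_prop
      simpa using this.tendsto (x₀ : E)
    exact (isLittleO_pow_pow one_lt_two).comp_tendsto h4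
  exact (h3.congr_right fun _ => pow_one _).of_norm_right

theorem isClosed_weightedPredual :
    IsClosed (weightedPredual U v : Set (StrongDual ℂ (WeightedHol U v ℂ))) :=
  Submodule.isClosed_topologicalClosure _

instance : CompleteSpace (weightedPredual U v) :=
  isClosed_weightedPredual.completeSpace_coe

/-- The derivative of `x ↦ δ_x` takes its values in the closed subspace `G_v^∞(U)`, so `x ↦ δ_x` is
holomorphic as a map into that subspace. -/
theorem isHolomorphic_evalMap : IsHolomorphic U (evalMap U v) := by
  refine ⟨extendZero (evalMap U v), fun x hx => ?_, fun x => extendZero_coe _ x⟩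
  have hcoe : ∀ y : E, ((extendZero (evalMap U v) y : weightedPredual U v) :
      StrongDual ℂ (WeightedHol U v ℂ)) = extendZero (evalFunctional U v) y := fun y => by
    by_cases hy : y ∈ U
    · simp only [extendZero, hy, dif_pos]; rfl
    · simp [extendZero, hy]
  obtain ⟨L, hL⟩ := hasFDerivAt_extendZero_evalFunctional v ⟨x, hx⟩
  have hmem : ∀ u, L u ∈ weightedPredual U v := fun u => by
    have hlim := hL.lim u (c := fun n : ℕ => (n : ℂ)) (l := Filter.atTop) (by
      simpa using tendsto_natCast_atTop_atTop (R := ℝ))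
    refine isClosed_weightedPredual.mem_of_tendsto hlim (.of_forall fun n => ?_)
    rw [← hcoe, ← hcoe]
    exact Submodule.smul_mem _ _ (Submodule.sub_mem _ (Subtype.prop _) (Subtype.prop _))
  have hG : HasFDerivAt (extendZero (evalMap U v)) (L.codRestrict (weightedPredual U v) hmem) x := by
    refine .of_isLittleO ?_
    refine (isLittleO_norm_left.1 ?_)
    refine (isLittleO_norm_left.2 hL.isLittleO).congr_left fun y => ?_
    rw [← hcoe, ← hcoe]
    rfl
  exact hG.differentiableAt.differentiableWithinAt

theorem mul_norm_evalMap_le_one (x : U) : v x * ‖evalMap U v x‖ ≤ 1 := by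
  have h := mul_le_mul_of_nonneg_left (norm_evalFunctional_le (v := v) x) (v.pos x).le
  rw [mul_inv_cancel₀ (v.pos x).ne'] at h
  exact h

/-- The map `Δ_v : x ↦ δ_x` as an element of `H_v^∞(U, G_v^∞(U))`. -/
noncomputable def evalWeightedHol (U : Opens E) (v : Weight U) :
    WeightedHol U v (weightedPredual U v) :=
  ⟨evalMap U v, isHolomorphic_evalMap, 1, by
    rintro _ ⟨x, rfl⟩
    exact mul_norm_evalMap_le_one x⟩

theorem norm_evalWeightedHol_le_one : ‖evalWeightedHol U v‖ ≤ 1 :=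
  WeightedHol.norm_le _ zero_le_one mul_norm_evalMap_le_one

/-! ### Factorization through Grothendieck operators -/

variable {F : Type u} [NormedAddCommGroup F] [NormedSpace ℂ F]

theorem mem_grothendieckWeightedHol_of_factorization {f : WeightedHol U v F} {G : Type u}
    [NormedAddCommGroup G] [NormedSpace ℂ G] {S : G →L[ℂ] F} {g : WeightedHol U v G}
    (h : IsGrothendieckFactorization f G S g) : f ∈ grothendieckWeightedHol U v F := by
  intro T
  -- `v f` takes its values in the image under `T ∘ S` of the ball of radius `c`.
  have hc : (0 : ℝ) < ‖g‖ + 1 := by positivity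
  refine ((h.1 T).image (((‖g‖ + 1 : ℝ) : ℂ) • ContinuousLinearMap.id ℂ _)).mono ?_
  rintro _ ⟨_, ⟨x, rfl⟩, rfl⟩
  refine ⟨_, ⟨_, ⟨(((‖g‖ + 1 : ℝ) : ℂ)⁻¹ * (v x : ℂ)) • g x, ?_, rfl⟩, rfl⟩, ?_⟩
  · rw [mem_closedBall_zero_iff, norm_smul, norm_mul, norm_inv, Complex.norm_real,
      Complex.norm_real, Real.norm_of_nonneg hc.le, Real.norm_of_nonneg (v.pos x).le, mul_assoc,
      inv_mul_le_iff₀ hc]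
    linarith [g.le_norm x]
  · have hc' : ((‖g‖ + 1 : ℝ) : ℂ) ≠ 0 := Complex.ofReal_ne_zero.2 hc.ne'
    simp only [map_smul, smul_apply, ContinuousLinearMap.id_apply, h.2 x]
    rw [smul_smul, mul_right_comm, inv_mul_cancel₀ hc', one_mul]

theorem IsGrothendieckFactorization.norm_le {f : WeightedHol U v F} {G : Type u}
    [NormedAddCommGroup G] [NormedSpace ℂ G] {S : G →L[ℂ] F} {g : WeightedHol U v G}
    (h : IsGrothendieckFactorization f G S g) : ‖f‖ ≤ ‖S‖ * ‖g‖ := by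
  refine f.norm_le (by positivity) fun x => ?_
  rw [h.2 x]
  calc _ ≤ v x * (‖S‖ * ‖g x‖) := mul_le_mul_of_nonneg_left (S.le_opNorm _) (v.pos x).le
    _ = ‖S‖ * (v x * ‖g x‖) := by ring
    _ ≤ _ := mul_le_mul_of_nonneg_left (g.le_norm x) (norm_nonneg _)

/-! ### The linearization -/

variable [CompleteSpace F]

theorem linearization_evalMap (f : WeightedHol U v F) (x : U) :
    linearization f (evalMap U v x) = f x :=
  (existsUnique_linearization f).choose_spec.1 x

/-- Both sides are bounded linear in `g` and agree on the evaluation functionals. -/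
theorem apply_linearization (f : WeightedHol U v F) (y : StrongDual ℂ F) (g : weightedPredual U v) :
    y (linearization f g) = (g : StrongDual ℂ (WeightedHol U v ℂ)) (dualComp f y) := by
  let S : weightedPredual U v →L[ℂ] ℂ := y.comp (linearization f)
  let T : weightedPredual U v →L[ℂ] ℂ :=
    (ContinuousLinearMap.apply ℂ ℂ (dualComp f y)).comp (weightedPredual U v).subtypeL
  have hST : S = T := (existsUnique_linearization (dualComp f y)).unique
    (fun x => congrArg y (linearization_evalMap f x)) (fun x => rfl)
  exact DFunLike.congr_fun hST g

theorem norm_linearization (f : WeightedHol U v F) : ‖linearization f‖ = ‖f‖ := by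
  refine le_antisymm (ContinuousLinearMap.opNorm_le_bound _ (norm_nonneg _) fun g => ?_)
    (f.norm_le (norm_nonneg _) fun x => ?_)
  · refine NormedSpace.norm_le_dual_bound ℂ _ (by positivity) fun y => ?_
    rw [apply_linearization]
    calc _ ≤ ‖g‖ * ‖dualComp f y‖ := (g : StrongDual ℂ (WeightedHol U v ℂ)).le_opNorm _
      _ ≤ ‖g‖ * (‖f‖ * ‖y‖) := mul_le_mul_of_nonneg_left (norm_dualComp_le f y) (norm_nonneg _)
      _ = _ := by ring
  · rw [← linearization_evalMap]
    calc _ ≤ v x * (‖linearization f‖ * ‖evalMap U v x‖) :=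
          mul_le_mul_of_nonneg_left ((linearization f).le_opNorm _) (v.pos x).le
      _ = ‖linearization f‖ * (v x * ‖evalMap U v x‖) := by ring
      _ ≤ ‖linearization f‖ * 1 :=
          mul_le_mul_of_nonneg_left (mul_norm_evalMap_le_one x) (norm_nonneg _)
      _ = _ := mul_one _

/-! ### Grothendieck maps and Grothendieck operators -/

/-- The image of the unit ball under `T_f` lies in the absolute bipolar of `(v f)(U)`, because a
functional `y` with `|y| ≤ s` on `(v f)(U)` has `‖y ∘ f‖_v ≤ s`. -/
theorem linearization_mem_grothendieckOperators {f : WeightedHol U v F}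
    (hf : f ∈ grothendieckWeightedHol U v F) :
    linearization f ∈ grothendieckOperators (weightedPredual U v) F := by
  intro T
  refine (hf T).of_norm_apply_le ?_
  rintro φ s hs hφ _ ⟨_, ⟨g, hg, rfl⟩, rfl⟩
  have h1 : ‖dualComp f (φ.comp T)‖ ≤ s := WeightedHol.norm_le _ hs fun x => by
    have h := hφ _ ⟨_, ⟨x, rfl⟩, rfl⟩
    rw [map_smul, map_smul, norm_smul, Complex.norm_real, Real.norm_of_nonneg (v.pos x).le] at h
    exact h
  have h2 := apply_linearization f (φ.comp T) g
  rw [ContinuousLinearMap.comp_apply] at h2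
  rw [h2]
  calc _ ≤ ‖g‖ * ‖dualComp f (φ.comp T)‖ :=
        (g : StrongDual ℂ (WeightedHol U v ℂ)).le_opNorm _
    _ ≤ 1 * s := mul_le_mul (mem_closedBall_zero_iff.1 hg) h1 (norm_nonneg _) zero_le_one
    _ = s := one_mul s

theorem isGrothendieckFactorization_linearization {f : WeightedHol U v F}
    (hf : linearization f ∈ grothendieckOperators (weightedPredual U v) F) :
    IsGrothendieckFactorization f (weightedPredual U v) (linearization f) (evalWeightedHol U v) :=
  ⟨hf, fun x => (linearization_evalMap f x).symm⟩

theorem grothendieckCompositionNorm_eq {f : WeightedHol U v F}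
    (hf : linearization f ∈ grothendieckOperators (weightedPredual U v) F) :
    grothendieckCompositionNorm f = ‖linearization f‖ := by
  have hmem : ‖linearization f‖ * ‖evalWeightedHol U v‖ ∈
      {r | ∃ (G : Type u) (_ : NormedAddCommGroup G) (_ : NormedSpace ℂ G) (_ : CompleteSpace G)
        (S : G →L[ℂ] F) (g : WeightedHol U v G),
        IsGrothendieckFactorization f G S g ∧ r = ‖S‖ * ‖g‖} :=
    ⟨_, _, _, inferInstance, _, _, isGrothendieckFactorization_linearization hf, rfl⟩
  have hlb : ∀ r ∈ {r | ∃ (G : Type u) (_ : NormedAddCommGroup G) (_ : NormedSpace ℂ G)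
      (_ : CompleteSpace G) (S : G →L[ℂ] F) (g : WeightedHol U v G),
      IsGrothendieckFactorization f G S g ∧ r = ‖S‖ * ‖g‖}, ‖linearization f‖ ≤ r := by
    rintro _ ⟨G, _, _, _, S, g, h, rfl⟩
    exact (norm_linearization f).trans_le h.norm_le
  refine le_antisymm ((csInf_le ⟨_, hlb⟩ hmem).trans ?_) (le_csInf ⟨_, hmem⟩ hlb)
  exact mul_le_of_le_one_right (norm_nonneg _) norm_evalWeightedHol_le_one

end WeightedHol

theorem mainTheorem3 {E : Type u} [NormedAddCommGroup E] [NormedSpace ℂ E] [CompleteSpace E]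
    (U : Opens E) (v : Weight U)
    (F : Type u) [NormedAddCommGroup F] [NormedSpace ℂ F] [CompleteSpace F] :
    (∀ f : WeightedHol U v F,
      [f ∈ grothendieckWeightedHol U v F,
        linearization f ∈ grothendieckOperators (weightedPredual U v) F,
        f ∈ grothendieckComposition U v F].TFAE ∧
      (f ∈ grothendieckWeightedHol U v F →
        ‖f‖ = ‖linearization f‖ ∧ ‖linearization f‖ = grothendieckCompositionNorm f)) ∧
    HasLinearizationProperty (grothendieckWeightedHol U v F) (fun f => ‖f‖)
      (grothendieckOperators (weightedPredual U v) F) (fun T => ‖T‖) := by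
  have htfae : ∀ f : WeightedHol U v F,
      [f ∈ grothendieckWeightedHol U v F,
        linearization f ∈ grothendieckOperators (weightedPredual U v) F,
        f ∈ grothendieckComposition U v F].TFAE := fun f => by
    tfae_have 1 → 2 := linearization_mem_grothendieckOperators
    tfae_have 2 → 3 := fun h =>
      ⟨_, _, _, inferInstance, _, _, isGrothendieckFactorization_linearization h⟩
    tfae_have 3 → 1 := by
      rintro ⟨G, _, _, _, S, g, h⟩
      exact mem_grothendieckWeightedHol_of_factorization h
    tfae_finish
  exact ⟨fun f => ⟨htfae f, fun hf => ⟨(norm_linearization f).symm,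
    (grothendieckCompositionNorm_eq (linearization_mem_grothendieckOperators hf)).symm⟩⟩,
    fun f => ⟨(htfae f).out 0 1, fun _ => (norm_linearization f).symm⟩⟩
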